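/- **Setting.** Let $N$ be an undirected graph on a finite non-empty set $A$ of agents, $F$ an undirected graph on a finite non-empty set $K$ of actions, $n,f\ge 0$ integers, $d=n+f$. Let $q(v)\in(0,1]$ for $v\in A$, $Q=\sum_{v\in A}q(v)$, and let $\ell_1,\ell_2,\dots\colon K\to[0,1]$ be losses fixed in advance. For a graph $G$ write $\delta_G$ for the shortest-path distance ($\infty$ between different components), $\mathcal N_m^G(v)=\{u:\delta_G(u,v)\le m\}$, $G^m$ for the graph on the same vertices in which distinct $u,v$ are adjacent iff $\delta_G(u,v)\le m$, $\alpha(G)$ for the independence number, and $G\boxtimes H$ for the strong product (distinct pairs are adjacent iff in each coordinate their entries are equal or adjacent). In each round $t=1,2,\dots$, given the past, the agents act independently of one another: agent $v$ is active with probability $q(v)$ and, if active, draws an action $I_t(v)\in K$ from $p_t(\cdot,v)$. Let $\mathcal A_t$ be the set of active agents. All agents run the algorithm Exp3-$\alpha^2$ with the same learning rate $\eta$, updating whether or not they were active (oblivious network interface): with $w_t(i,v)=\exp\big(-\eta\sum_{s=1}^{t-d-1}\hat\ell_s(i,v)\big)$ (an empty sum if $t\le d+1$), $$p_t(i,v)=\frac{w_t(i,v)}{\sum_{j\in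 K}w_t(j,v)},\qquad \hat\ell_s(i,v)=\ell_s(i)\frac{B_s(i,v)}{b_s(i,v)},$$ where $B_s(i,v)$ is the indicator of the event that some $u\in\mathcal N_n^N(v)\cap\mathcal A_s$ has $I_s(u)\in\mathcal N_f^F(i)$, and $b_s(i,v)=1-\prod_{u\in\mathcal N_n^N(v)}\big(1-q(u)\sum_{j\in\mathcal N_f^F(i)}p_s(j,u)\big)$. The network regret is $$R_T=\max_{i\in K}\mathbb E\Big[\sum_{t=1}^T\sum_{v\in\mathcal A_t}\ell_t(I_t(v))-\sum_{t=1}^T|\mathcal A_t|\,\ell_t(i)\Big].$$ **Theorem.** (1) For every $\eta>0$ and every $T$, $$\frac{R_T}{Q}\le d+\frac{\ln|K|}{\eta}+\eta T\left(\frac{\alpha(N^n\boxtimes F^f)/Q+1}{1-e^{-1}}+d\right).$$ (2) For $T\ge1$ and $\eta=\sqrt{\ln|K|\,/\,\big(T(\alpha(N^n\boxtimes F^f)/Q+d+1)\big)}$, we have $R_T/Q=\tilde O\big(\sqrt{(\alpha(N^n\boxtimes F^f)/Q+d)\,T}\big)$; precisely, there is an absolute constant $C>0$ (independent of all the data above)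 such that $$\frac{R_T}{Q}\le C\sqrt{\ln|K|\,\big(\alpha(N^n\boxtimes F^f)/Q+d\big)\,T}.$$ -/

import Mathlib

open scoped BigOperators

/-- The closed `m`-neighborhood of `v` in `G`: the vertices at shortest-path distance at most `m`
from `v` (it contains `v` itself; vertices in different components are at distance `⊤`). -/
noncomputable def SimpleGraph.closedNbhd {V : Type*} [Fintype V] (G : SimpleGraph V) (m : ℕ)
    (v : V) : Finset V := by
  classical exact Finset.univ.filter fun u => G.edist v u ≤ m

/-- The `m`-th power of `G`: two (distinct) vertices are adjacent iff their shortest-path distance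
in `G` is at most `m`. (Self-loops are left implicit, as always for `SimpleGraph`.) -/
def SimpleGraph.distPower {V : Type*} (G : SimpleGraph V) (m : ℕ) : SimpleGraph V where
  Adj u v := u ≠ v ∧ G.edist u v ≤ m
  symm := ⟨fun _ _ h => ⟨h.1.symm, G.edist_comm ▸ h.2⟩⟩
  loopless := ⟨fun _ h => h.1 rfl⟩

/-- The strong product: distinct pairs `(u, u')`, `(v, v')` are adjacent iff `u` and `v` are equal
or adjacent in `G`, and `u'` and `v'` are equal or adjacent in `H`. -/
def SimpleGraph.strongProd {V W : Type*} (G : SimpleGraph V) (H : SimpleGraph W) :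
    SimpleGraph (V × W) where
  Adj x y := x ≠ y ∧ (x.1 = y.1 ∨ G.Adj x.1 y.1) ∧ (x.2 = y.2 ∨ H.Adj x.2 y.2)
  symm := ⟨fun _ _ h => ⟨h.1.symm, h.2.1.imp Eq.symm (fun a => a.symm),
    h.2.2.imp Eq.symm (fun a => a.symm)⟩⟩
  loopless := ⟨fun _ h => h.1 rfl⟩

/-- An instance of the cooperative online learning problem with agents `A` and actions `K`.
Rounds are numbered `1, 2, …`; the losses are fixed in advance (oblivious adversary). -/
structure CoopInstance (A K : Type*) where
  /-- communication network -/
  N : SimpleGraph A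
  /-- maximum communication delay -/
  n : ℕ
  /-- feedback graph -/
  F : SimpleGraph K
  /-- maximum feedback delay -/
  f : ℕ
  /-- activation probabilities -/
  q : A → ℝ
  q_pos : ∀ v, 0 < q v
  q_le_one : ∀ v, q v ≤ 1
  /-- `loss t i` is the loss of action `i` in round `t` -/
  loss : ℕ → K → ℝ
  loss_nonneg : ∀ t i, 0 ≤ loss t i
  loss_le_one : ∀ t i, loss t i ≤ 1

/-- What happens in one round: `none` for an inactive agent, `some i` for an active agent that
plays the action `i`. -/
abbrev RoundOutcome (A K : Type*) := A → Option K

namespace CoopInstance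

variable {A K : Type*} [Fintype A] [Fintype K] (P : CoopInstance A K)

/-- The total delay `d = n + f`. -/
def d : ℕ := P.n + P.f

/-- The expected number of active agents per round. -/
noncomputable def Q : ℝ := ∑ v, P.q v

/-- The independence number of the strong product of `N ^ n` and `F ^ f`. -/
noncomputable def alpha : ℕ := ((P.N.distPower P.n).strongProd (P.F.distPower P.f)).indepNum

/-- `B(i, v)`: indicator that in the round with outcome `o` some active agent in the
`n`-neighborhood of `v` played an action in the `f`-neighborhood of `i`. -/
noncomputable def B (o : RoundOutcome A K) (i : K) (v : A) : ℝ := by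
  classical exact
    if ∃ u ∈ P.N.closedNbhd P.n v, ∃ j ∈ P.F.closedNbhd P.f i, o u = some j then 1 else 0

/-- `b(i, v)` in a round in which each agent `u` uses the distribution `p · u`. -/
noncomputable def b (p : K → A → ℝ) (i : K) (v : A) : ℝ :=
  1 - ∏ u ∈ P.N.closedNbhd P.n v, (1 - P.q u * ∑ j ∈ P.F.closedNbhd P.f i, p j u)

/-- The importance-weighted loss estimate of action `i` held by agent `v` for round `s`, when the
agents used the distributions `p` in that round and its outcome was `o`. -/
noncomputable def lossEst (s : ℕ) (p : K → A → ℝ) (o : RoundOutcome A K) (i : K) (v : A) : ℝ :=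
  P.loss s i * P.B o i v / P.b p i v

/-- The distributions of Exp3-α² with learning rate `η`: `P.prob η x t i v` is `p_t(i, v)`, the
probability with which agent `v` draws action `i` in round `t`, if active, when the outcomes of the
earlier rounds are given by `x`. It is proportional to
`exp (-η ∑ s = 1, …, t - d - 1, lossEst_s(i, v))`; the subtraction truncates, so that the
distribution is uniform in the rounds `1, …, d + 1`. All agents use the same `η`, and update
whether or not they were active. -/
noncomputable def prob (η : ℝ) (x : ℕ → RoundOutcome A K) (t : ℕ) (i : K) (v : A) : ℝ :=
  Real.exp (-η * ∑ s ∈ (Finset.Icc 1 (t - P.d - 1)).attach,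
      P.lossEst s (prob η x s) (x s) i v) /
    ∑ j, Real.exp (-η * ∑ s ∈ (Finset.Icc 1 (t - P.d - 1)).attach,
      P.lossEst s (prob η x s) (x s) j v)
termination_by t
decreasing_by all_goals (have h := Finset.mem_Icc.1 s.2; omega)

/-- The exponential weight `w_t(i, v)`. -/
noncomputable def weight (η : ℝ) (x : ℕ → RoundOutcome A K) (t : ℕ) (i : K) (v : A) : ℝ :=
  Real.exp (-η * ∑ s ∈ Finset.Icc 1 (t - P.d - 1), P.lossEst s (P.prob η x s) (x s) i v)

/-- The recursion that defines the algorithm, without the bookkeeping for termination. -/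
theorem prob_eq (η : ℝ) (x : ℕ → RoundOutcome A K) (t : ℕ) (i : K) (v : A) :
    P.prob η x t i v = P.weight η x t i v / ∑ j, P.weight η x t j v := by
  have h : ∀ j, P.weight η x t j v =
      Real.exp (-η * ∑ s ∈ (Finset.Icc 1 (t - P.d - 1)).attach,
        P.lossEst s (P.prob η x s) (x s) j v) := fun j => by
    rw [weight, ← Finset.sum_attach]
  rw [prob]
  simp only [h]

/-- Probability, in round `t` and given the outcomes `x` of the earlier rounds, that agent `v` does
`a`: it is active with probability `q v`, and then draws its action from `p_t(·, v)`. -/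
noncomputable def agentProb (η : ℝ) (x : ℕ → RoundOutcome A K) (t : ℕ) (v : A) :
    Option K → ℝ
  | none => 1 - P.q v
  | some i => P.q v * P.prob η x t i v

/-- `X t ω` is the outcome of round `t ≥ 1` when all agents run Exp3-α² with learning rate `η`.
The law of the process is the one of the protocol: given the outcomes of the rounds `1, …, t - 1`,
the agents act independently of one another in round `t`, each agent `v` according to
`agentProb`. -/
structure IsRun {Ω : Type*} [MeasurableSpace Ω] (η : ℝ) (X : ℕ → Ω → RoundOutcome A K)
    (μ : MeasureTheory.Measure Ω) : Prop where
  measurableSet_eq : ∀ t, 1 ≤ t → ∀ o, MeasurableSet {ω | X t ω = o}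
  law : ∀ t, 1 ≤ t → ∀ x : ℕ → RoundOutcome A K,
    μ.real {ω | ∀ s ∈ Finset.Icc 1 t, X s ω = x s} =
      μ.real {ω | ∀ s ∈ Finset.Icc 1 (t - 1), X s ω = x s} *
        ∏ v, P.agentProb η x t v (x t v)

/-- The total loss of the active agents in round `t` with outcome `o`. -/
noncomputable def activeLoss (t : ℕ) (o : RoundOutcome A K) : ℝ :=
  ∑ v, (o v).elim 0 (P.loss t)

/-- The network regret `R_T`. -/
noncomputable def regret {Ω : Type*} [MeasurableSpace Ω] (X : ℕ → Ω → RoundOutcome A K)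
    (μ : MeasureTheory.Measure Ω) (T : ℕ) : ℝ :=
  ⨆ i : K, ∫ ω, (∑ t ∈ Finset.Icc 1 T, P.activeLoss t (X t ω) -
    ∑ t ∈ Finset.Icc 1 T, ((Finset.univ.filter fun v => (X t ω v).isSome).card : ℝ) * P.loss t i) ∂μ

end CoopInstance

/-! Every agent runs exponential weights on its own loss estimates, so a pathwise bound for a single
learner, weighted by `q v` and summed over `v`, controls the network regret once expectations are
taken. The estimates are unbiased given the past (`sum_outcomeProb_mul_lossEst`), so they may
replace the true losses in the regret. `expWeights_delayed_regret_le` then leaves three terms: `log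
|K| / η`, a second moment, and the correlation of the current estimate with those the delay has
hidden. The second moment of an estimate is at most `1 / b`. Since `1 / b` is at most a constant
times one plus the inverse expected number of useful plays, its sum against the weights `q v * p i
v` is a weighted Caro–Wei sum in the strong product of the two graph powers, hence of order `alpha +
Q` (`sum_div_b_le`). The correlation term has at most `d` summands per round. By the delay, `p_t`
ignores the rounds whose estimates are missing, so conditioning on the past twice bounds each
summand by `Q` (`IsRun.runExpect_lossEst_mul_sum_le`). -/

/-! ### Weighted Caro–Wei bound and neighborhoods in the strong product. -/

open Classical in
/-- Weighted Caro–Wei bound, relative to a set of vertices. -/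
theorem SimpleGraph.exists_isIndepSet_sum_div_le {V : Type*} (G : SimpleGraph V) {z : V → ℝ}
    (hz : ∀ v, 0 < z v) (S : Finset V) :
    ∃ I ⊆ S, G.IsIndepSet (I : Set V) ∧
      ∑ x ∈ S, z x / ∑ y ∈ S with (y = x ∨ G.Adj x y), z y ≤ I.card := by
  induction S using Finset.strongInduction with
  | H S ih =>
    rcases S.eq_empty_or_nonempty with rfl | hS
    · exact ⟨∅, by simp, by simp [SimpleGraph.IsIndepSet], by simp⟩
    -- Greedy choice: the closed neighborhood of lightest total weight is removed. Its terms keep a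
    -- denominator at least that weight, so together they contribute at most 1, which pays for
    -- adding `x₀` to the independent set.
    obtain ⟨x₀, hx₀, hmin⟩ := S.exists_min_image
      (fun x => ∑ y ∈ S with (y = x ∨ G.Adj x y), z y) hS
    have hD : ∀ S' : Finset V, ∀ x ∈ S', 0 < ∑ y ∈ S' with (y = x ∨ G.Adj x y), z y :=
      fun S' x hx => Finset.sum_pos (fun y _ => hz y) ⟨x, by simp [hx]⟩
    set S' := S.filter fun y => ¬(y = x₀ ∨ G.Adj x₀ y) with hS'
    obtain ⟨I, hIS, hI, hsum⟩ := ih S' (Finset.filter_ssubset.2 ⟨x₀, hx₀, by simp⟩)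
    have hx₀I : x₀ ∉ I := fun h => by simpa [hS'] using hIS h
    refine ⟨insert x₀ I, ?_, ?_, ?_⟩
    · exact Finset.insert_subset hx₀ (hIS.trans (Finset.filter_subset _ _))
    · rw [Finset.coe_insert]
      have : Std.Symm fun v w => ¬G.Adj v w := ⟨fun _ _ h h' => h h'.symm⟩
      refine Set.pairwise_insert_of_symm.2 ⟨hI, fun y hy _ h => ?_⟩
      have := hIS hy
      simp only [hS', Finset.mem_filter, not_or] at this
      exact this.2.2 h
    · rw [← Finset.sum_filter_add_sum_filter_not S (fun y => y = x₀ ∨ G.Adj x₀ y),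
        Finset.card_insert_of_notMem hx₀I, Nat.cast_add, Nat.cast_one, add_comm (I.card : ℝ)]
      refine add_le_add ?_ (le_trans (Finset.sum_le_sum fun x hx => ?_) hsum)
      · calc _ ≤ ∑ x ∈ S with (x = x₀ ∨ G.Adj x₀ x),
              z x / ∑ y ∈ S with (y = x₀ ∨ G.Adj x₀ y), z y :=
            Finset.sum_le_sum fun x hx => div_le_div_of_nonneg_left (hz x).le (hD S x₀ hx₀)
              (hmin x (Finset.mem_filter.1 hx).1)
          _ = 1 := by
            rw [← Finset.sum_div, div_self (hD S x₀ hx₀).ne']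
      -- Passing to `S'` only shrinks denominators, so the remaining terms are dominated by those in
      -- the induction hypothesis.
      · refine div_le_div_of_nonneg_left (hz x).le (hD S' x hx) ?_
        exact Finset.sum_le_sum_of_subset_of_nonneg
          (Finset.filter_subset_filter _ (Finset.filter_subset _ _)) fun y _ _ => (hz y).le

open Classical in
/-- Weighted Caro–Wei bound. -/
theorem SimpleGraph.sum_div_sum_closed_le_indepNum {V : Type*} [Fintype V] (G : SimpleGraph V)
    {z : V → ℝ} (hz : ∀ v, 0 < z v) :
    ∑ x, z x / ∑ y with (y = x ∨ G.Adj x y), z y ≤ G.indepNum := by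
  obtain ⟨I, -, hI, h⟩ := G.exists_isIndepSet_sum_div_le hz Finset.univ
  exact h.trans (by exact_mod_cast hI.card_le_indepNum)

theorem SimpleGraph.mem_closedNbhd {V : Type*} [Fintype V] {G : SimpleGraph V} {m : ℕ} {u v : V} :
    u ∈ G.closedNbhd m v ↔ G.edist v u ≤ m := by
  simp [SimpleGraph.closedNbhd]

theorem SimpleGraph.self_mem_closedNbhd {V : Type*} [Fintype V] (G : SimpleGraph V) (m : ℕ)
    (v : V) : v ∈ G.closedNbhd m v := by
  simp [SimpleGraph.mem_closedNbhd]

theorem SimpleGraph.eq_or_adj_distPower {V : Type*} [Fintype V] {G : SimpleGraph V} {m : ℕ}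
    {u v : V} : (v = u ∨ (G.distPower m).Adj v u) ↔ u ∈ G.closedNbhd m v := by
  rw [SimpleGraph.mem_closedNbhd]
  constructor
  · rintro (rfl | h)
    · simp
    · exact h.2
  · intro h
    by_cases e : v = u
    · exact .inl e
    · exact .inr ⟨e, h⟩

/-- Turns the Caro–Wei denominators into double sums over an agent neighborhood and an action
neighborhood. -/
theorem SimpleGraph.eq_or_adj_strongProd_distPower {V W : Type*} [Fintype V] [Fintype W]
    {G : SimpleGraph V} {H : SimpleGraph W} {m k : ℕ} {x y : V × W} :
    (y = x ∨ ((G.distPower m).strongProd (H.distPower k)).Adj x y) ↔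
      y ∈ G.closedNbhd m x.1 ×ˢ H.closedNbhd k x.2 := by
  rw [Finset.mem_product, ← SimpleGraph.eq_or_adj_distPower, ← SimpleGraph.eq_or_adj_distPower]
  constructor
  · rintro (rfl | h)
    · simp
    · exact h.2
  · intro h
    by_cases e : x = y
    · exact .inl e.symm
    · exact .inr ⟨e, h⟩

/-! ### Exponential weights with delayed losses. -/

/-- Multiply by `exp x ≥ 1 + x + x ^ 2 / 2` and use `(1 - x + x ^ 2 / 2) * (1 + x + x ^ 2 / 2) = 1 +
x ^ 4 / 4`. -/
theorem Real.exp_neg_le_quadratic {x : ℝ} (hx : 0 ≤ x) : Real.exp (-x) ≤ 1 - x + x ^ 2 / 2 := by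
  have h := Real.quadratic_le_exp_of_nonneg hx
  have h1 : Real.exp (-x) * Real.exp x = 1 := by rw [← Real.exp_add]; simp
  have h2 : 0 < 1 - x + x ^ 2 / 2 := by nlinarith [sq_nonneg (x - 1)]
  have h3 : 1 ≤ (1 - x + x ^ 2 / 2) * Real.exp x := by
    have := mul_le_mul_of_nonneg_left h h2.le
    nlinarith [sq_nonneg (x ^ 2)]
  nlinarith [Real.exp_pos x]

/-- One step of the potential argument for exponential weights, where the distribution played is
missing the losses `D`. -/
theorem log_sum_exp_step_le {K : Type*} [Fintype K] [Nonempty K] {η : ℝ} (hη : 0 ≤ η)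
    (M D g : K → ℝ) (hD : ∀ i, 0 ≤ D i) (hg : ∀ i, 0 ≤ g i) (p : K → ℝ)
    (hp : ∀ i, p i = Real.exp (-η * M i) / ∑ j, Real.exp (-η * M j)) :
    Real.log (∑ i, Real.exp (-η * (M i + D i + g i))) -
        Real.log (∑ i, Real.exp (-η * (M i + D i))) ≤
      -(η * (∑ i, p i * g i - (η / 2 * ∑ i, p i * g i ^ 2 + η * ∑ i, p i * (g i * D i)))) := by
  have hpos : ∀ f : K → ℝ, 0 < ∑ i, Real.exp (f i) := fun f =>
    Finset.sum_pos (fun i _ => Real.exp_pos _) Finset.univ_nonempty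
  set W := ∑ j, Real.exp (-η * M j) with hW
  set V := ∑ i, Real.exp (-η * (M i + D i)) with hV
  have hW0 : 0 < W := hpos _
  have hV0 : 0 < V := hpos _
  have hVW : V ≤ W := Finset.sum_le_sum fun i _ =>
    Real.exp_le_exp.2 (by nlinarith [mul_nonneg hη (hD i)])
  rw [← Real.log_div (hpos _).ne' hV0.ne']
  refine (Real.log_le_sub_one_of_pos (div_pos (hpos _) hV0)).trans ?_
  have e1 : (∑ i, Real.exp (-η * (M i + D i + g i))) / V - 1 =
      ∑ i, -(Real.exp (-η * (M i + D i)) / V * (1 - Real.exp (-(η * g i)))) := by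
    have h1 : ∑ i, Real.exp (-η * (M i + D i)) / V = 1 := by
      rw [← Finset.sum_div, div_self hV0.ne']
    refine (congrArg (_ - ·) h1.symm).trans ?_
    rw [Finset.sum_div, ← Finset.sum_sub_distrib]
    refine Finset.sum_congr rfl fun i _ => ?_
    rw [show -η * (M i + D i + g i) = -η * (M i + D i) + -(η * g i) by ring, Real.exp_add]
    ring
  rw [e1, Finset.mul_sum, Finset.mul_sum, ← Finset.sum_add_distrib, ← Finset.sum_sub_distrib,
    Finset.mul_sum, ← Finset.sum_neg_distrib]
  refine Finset.sum_le_sum fun i _ => neg_le_neg ?_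
  have hηg := mul_nonneg hη (hg i)
  have hy1 : Real.exp (-(η * g i)) ≤ 1 - η * g i + (η * g i) ^ 2 / 2 :=
    Real.exp_neg_le_quadratic hηg
  have hy2 : 1 - η * g i ≤ Real.exp (-(η * g i)) := Real.one_sub_le_exp_neg _
  have hy0 : 0 ≤ 1 - Real.exp (-(η * g i)) := by
    have : Real.exp (-(η * g i)) ≤ 1 := Real.exp_le_one_iff.2 (by linarith)
    linarith
  have hp0 : 0 ≤ p i := by rw [hp]; positivity
  -- The undelayed distribution is at least `p i * (1 - η * D i)`: the missing losses shrink the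
  -- weight by `exp (-η * D i)`, while the normalization only decreases. The deficit `η * D i`
  -- produces the cross term.
  have hP : p i * (1 - η * D i) ≤ Real.exp (-η * (M i + D i)) / V := by
    calc p i * (1 - η * D i) ≤ p i * Real.exp (-(η * D i)) :=
          mul_le_mul_of_nonneg_left (Real.one_sub_le_exp_neg _) hp0
      _ = Real.exp (-η * (M i + D i)) / W := by
          rw [hp, div_mul_eq_mul_div, ← Real.exp_add]; congr 2; ring
      _ ≤ _ := div_le_div_of_nonneg_left (Real.exp_pos _).le hV0 hVW
  have h1 := mul_le_mul_of_nonneg_right hP hy0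
  have h2 : p i * (1 - Real.exp (-(η * g i))) ≥ p i * (η * g i - (η * g i) ^ 2 / 2) :=
    mul_le_mul_of_nonneg_left (by linarith) hp0
  have h3 : p i * (η * D i) * (1 - Real.exp (-(η * g i))) ≤ p i * (η * D i) * (η * g i) :=
    mul_le_mul_of_nonneg_left (by linarith) (mul_nonneg hp0 (mul_nonneg hη (hD i)))
  nlinarith

/-- Regret bound for exponential weights with delay `d`: the price of the delay is the last term. -/
theorem expWeights_delayed_regret_le {K : Type*} [Fintype K] [Nonempty K] {η : ℝ} (hη : 0 < η)
    (d : ℕ) (g : ℕ → K → ℝ) (hg : ∀ t i, 0 ≤ g t i) (p : ℕ → K → ℝ)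
    (hp : ∀ t i, p t i = Real.exp (-η * ∑ s ∈ Finset.Icc 1 (t - d - 1), g s i) /
      ∑ j, Real.exp (-η * ∑ s ∈ Finset.Icc 1 (t - d - 1), g s j)) (T : ℕ) (k : K) :
    ∑ t ∈ Finset.Icc 1 T, (∑ i, p t i * g t i - g t k) ≤ Real.log (Fintype.card K) / η +
      ∑ t ∈ Finset.Icc 1 T, (η / 2 * ∑ i, p t i * g t i ^ 2 +
        η * ∑ i, p t i * (g t i * ∑ s ∈ Finset.Ioc (t - d - 1) (t - 1), g s i)) := by
  -- The potential uses all losses up to `m`, without delay, so that it telescopes; the delay shows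
  -- only in the comparison with `p t`.
  set Φ : ℕ → ℝ := fun m => Real.log (∑ i, Real.exp (-η * ∑ s ∈ Finset.Icc 1 m, g s i)) with hΦ
  have hIcc : ∀ m, Finset.Icc 1 m = Finset.Ioc 0 m := fun m => by ext; simp; omega
  have hstep : ∀ t, 1 ≤ t → Φ t - Φ (t - 1) ≤
      -(η * (∑ i, p t i * g t i - (η / 2 * ∑ i, p t i * g t i ^ 2 +
        η * ∑ i, p t i * (g t i * ∑ s ∈ Finset.Ioc (t - d - 1) (t - 1), g s i)))) := by
    intro t ht
    have h1 : ∀ i, ∑ s ∈ Finset.Icc 1 (t - 1), g s i = ∑ s ∈ Finset.Icc 1 (t - d - 1), g s i +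
        ∑ s ∈ Finset.Ioc (t - d - 1) (t - 1), g s i := fun i => by
      rw [hIcc, hIcc, Finset.sum_Ioc_consecutive _ (by omega) (by omega)]
    have h2 : ∀ i, ∑ s ∈ Finset.Icc 1 t, g s i = ∑ s ∈ Finset.Icc 1 (t - 1), g s i + g t i := by
      intro i
      obtain ⟨t, rfl⟩ : ∃ t', t = t' + 1 := ⟨t - 1, by omega⟩
      rw [Finset.sum_Icc_succ_top (by omega)]; simp
    have := log_sum_exp_step_le hη.le (fun i => ∑ s ∈ Finset.Icc 1 (t - d - 1), g s i)
      (fun i => ∑ s ∈ Finset.Ioc (t - d - 1) (t - 1), g s i) (g t)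
      (fun i => Finset.sum_nonneg fun s _ => hg s i) (hg t) (p t) (hp t)
    simpa only [hΦ, h2, h1] using this
  have htel : ∀ T : ℕ, ∑ t ∈ Finset.Icc 1 T, (Φ t - Φ (t - 1)) = Φ T - Φ 0 := by
    intro T
    induction T with
    | zero => simp
    | succ T ih => rw [Finset.sum_Icc_succ_top (by omega), ih]; simp
  have hsum := Finset.sum_le_sum fun t (ht : t ∈ Finset.Icc 1 T) => hstep t (Finset.mem_Icc.1 ht).1
  rw [htel, Finset.sum_neg_distrib, ← Finset.mul_sum, Finset.sum_sub_distrib] at hsum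
  have h0 : Φ 0 = Real.log (Fintype.card K) := by simp [hΦ]
  have hT : -(η * ∑ t ∈ Finset.Icc 1 T, g t k) ≤ Φ T := by
    rw [Real.le_log_iff_exp_le (Finset.sum_pos (fun i _ => Real.exp_pos _) Finset.univ_nonempty)]
    rw [← neg_mul]
    exact Finset.single_le_sum
      (f := fun i => Real.exp (-η * ∑ s ∈ Finset.Icc 1 T, g s i))
      (fun i _ => (Real.exp_pos _).le) (Finset.mem_univ k)
  rw [h0] at hsum
  rw [Finset.sum_sub_distrib, div_add' _ _ _ hη.ne', le_div_iff₀ hη]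
  nlinarith

namespace CoopInstance

open MeasureTheory

/-! ### Expectations over finite paths. -/

section Paths

variable {Ω O : Type*} [MeasurableSpace Ω]

theorem integral_comp_eq_sum {ι : Type*} [Fintype ι] (μ : Measure Ω) [IsFiniteMeasure μ]
    (Y : Ω → ι) (hY : ∀ y, MeasurableSet {ω | Y ω = y}) (h : ι → ℝ) :
    ∫ ω, h (Y ω) ∂μ = ∑ y, μ.real {ω | Y ω = y} * h y := by
  let _ : MeasurableSpace ι := ⊤
  have hYm : Measurable Y := measurable_to_countable' fun y => hY y
  rw [← integral_map (φ := Y) hYm.aemeasurable (measurable_from_top.aestronglyMeasurable),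
    integral_fintype .of_finite]
  refine Finset.sum_congr rfl fun y _ => ?_
  rw [map_measureReal_apply hYm trivial]
  rfl

/-- The path with the values `y` in the rounds `1, …, t`, and the value `o` elsewhere. -/
noncomputable def extendPath {t : ℕ} (y : Finset.Icc 1 t → O) (o : O) (s : ℕ) : O :=
  if h : s ∈ Finset.Icc 1 t then y ⟨s, h⟩ else o

theorem extendPath_of_mem {t : ℕ} (y : Finset.Icc 1 t → O) (o : O) {s : ℕ}
    (h : s ∈ Finset.Icc 1 t) : extendPath y o s = y ⟨s, h⟩ := dif_pos h

theorem extendPath_of_lt {t : ℕ} (y : Finset.Icc 1 t → O) (o : O) {s : ℕ}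
    (h : t < s) : extendPath y o s = o :=
  dif_neg fun h' => by rw [Finset.mem_Icc] at h'; omega

theorem setOf_path_eq {Ω O : Type*} {t : ℕ} (X : ℕ → Ω → O) (y : Finset.Icc 1 t → O) (o : O) :
    {ω | (fun s : Finset.Icc 1 t => X s ω) = y} =
      {ω | ∀ s ∈ Finset.Icc 1 t, X s ω = extendPath y o s} := by
  ext ω
  simp only [Set.mem_ofPred_eq, funext_iff]
  exact ⟨fun h s hs => by rw [extendPath_of_mem y o hs, ← h ⟨s, hs⟩],
    fun h s => by rw [h s s.2, extendPath_of_mem]⟩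

theorem measurableSet_path_eq {X : ℕ → Ω → O}
    (hX : ∀ t, 1 ≤ t → ∀ o, MeasurableSet {ω | X t ω = o}) {t : ℕ} (y : Finset.Icc 1 t → O) :
    MeasurableSet {ω | (fun s : Finset.Icc 1 t => X s ω) = y} := by
  simp only [funext_iff, Set.ofPred_forall]
  exact MeasurableSet.iInter fun s => hX s (Finset.mem_Icc.1 s.2).1 _

variable [Fintype O]

open Classical in
/-- The expectation of a function of the path that depends on the rounds `1, …, T` only. -/
noncomputable def pathExpect (μ : Measure Ω) (X : ℕ → Ω → O) (o : O) (T : ℕ) :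
    ((ℕ → O) → ℝ) →ₗ[ℝ] ℝ :=
  ∑ y : Finset.Icc 1 T → O, μ.real {ω | (fun s : Finset.Icc 1 T => X s ω) = y} •
    LinearMap.proj (extendPath y o)

open Classical in
theorem pathExpect_apply (μ : Measure Ω) (X : ℕ → Ω → O) (o : O) (T : ℕ) (g : (ℕ → O) → ℝ) :
    pathExpect μ X o T g =
      ∑ y : Finset.Icc 1 T → O, μ.real {ω | (fun s : Finset.Icc 1 T => X s ω) = y} *
        g (extendPath y o) := by
  simp [pathExpect]

theorem pathExpect_mono (μ : Measure Ω) (X : ℕ → Ω → O) (o : O) (T : ℕ) {g h : (ℕ → O) → ℝ}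
    (hgh : ∀ x, g x ≤ h x) : pathExpect μ X o T g ≤ pathExpect μ X o T h := by
  classical
  rw [pathExpect_apply, pathExpect_apply]
  exact Finset.sum_le_sum fun y _ => mul_le_mul_of_nonneg_left (hgh _) measureReal_nonneg

variable (μ : Measure Ω) {X : ℕ → Ω → O}

/-- Reduces integrals to finite sums, which are linear and monotone with no integrability
conditions. The filler `o` is harmless because `g` ignores rounds outside `1, …, T`. -/
theorem integral_eq_pathExpect [IsFiniteMeasure μ]
    (hX : ∀ t, 1 ≤ t → ∀ o, MeasurableSet {ω | X t ω = o}) (o : O) (T : ℕ) {g : (ℕ → O) → ℝ}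
    (hg : DependsOn g (Set.Icc 1 T)) :
    ∫ ω, g (fun s => X s ω) ∂μ = pathExpect μ X o T g := by
  classical
  rw [pathExpect_apply, ← integral_comp_eq_sum μ (fun ω (s : Finset.Icc 1 T) => X s ω)
    (measurableSet_path_eq hX) fun y => g (extendPath y o)]
  refine integral_congr_ae (.of_forall fun ω => hg fun s hs => ?_)
  rw [extendPath_of_mem _ _ (Finset.mem_Icc.2 hs)]

theorem pathExpect_const [IsProbabilityMeasure μ]
    (hX : ∀ t, 1 ≤ t → ∀ o, MeasurableSet {ω | X t ω = o}) (o : O) (T : ℕ) (c : ℝ) :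
    pathExpect μ X o T (fun _ => c) = c := by
  rw [← integral_eq_pathExpect μ hX o T fun _ _ _ => rfl]
  simp

/-- Conditioning on the rounds before `t`, for a process whose transition probabilities are
given by `κ`. -/
theorem integral_eq_integral_sum_transition [IsFiniteMeasure μ] [Nonempty O]
    (hX : ∀ t, 1 ≤ t → ∀ o, MeasurableSet {ω | X t ω = o}) {t : ℕ} (ht : 1 ≤ t)
    {κ : (ℕ → O) → O → ℝ} (hκ : ∀ o, DependsOn (fun x => κ x o) (Set.Icc 1 (t - 1)))
    (hlaw : ∀ x : ℕ → O, μ.real {ω | ∀ s ∈ Finset.Icc 1 t, X s ω = x s} =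
      μ.real {ω | ∀ s ∈ Finset.Icc 1 (t - 1), X s ω = x s} * κ x (x t))
    {G : (ℕ → O) → O → ℝ} (hG : ∀ o, DependsOn (fun x => G x o) (Set.Icc 1 (t - 1))) :
    ∫ ω, G (fun s => X s ω) (X t ω) ∂μ =
      ∫ ω, ∑ o, κ (fun s => X s ω) o * G (fun s => X s ω) o ∂μ := by
  classical
  obtain ⟨o₀⟩ := ‹Nonempty O›
  have hext : ∀ (y : Finset.Icc 1 (t - 1) → O) (o o' : O), ∀ s ∈ Set.Icc 1 (t - 1),
      extendPath y o s = extendPath y o' s := fun y o o' s hs => by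
    rw [extendPath_of_mem _ _ (Finset.mem_Icc.2 hs), extendPath_of_mem _ _ (Finset.mem_Icc.2 hs)]
  let Y : Ω → (Finset.Icc 1 (t - 1) → O) × O := fun ω => (fun s => X s ω, X t ω)
  have hYm : ∀ y, MeasurableSet {ω | Y ω = y} := fun y => by
    simp only [Y, Prod.ext_iff, Set.ofPred_and]
    exact (measurableSet_path_eq hX _).inter (hX t ht _)
  let H : (Finset.Icc 1 (t - 1) → O) × O → ℝ := fun y => G (extendPath y.1 o₀) y.2
  have h1 : ∫ ω, G (fun s => X s ω) (X t ω) ∂μ =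
      ∫ ω, H (Y ω) ∂μ := by
    refine integral_congr_ae (.of_forall fun ω => hG _ fun s hs => ?_)
    rw [extendPath_of_mem _ _ (Finset.mem_Icc.2 hs)]
  rw [h1.trans (integral_comp_eq_sum μ Y hYm H), Fintype.sum_prod_type,
    integral_eq_pathExpect μ hX o₀ (t - 1) (g := fun x => ∑ o, κ x o * G x o)
      fun x x' h => Finset.sum_congr rfl fun o _ => congrArg₂ _ (hκ o h) (hG o h),
    pathExpect_apply]
  refine Finset.sum_congr rfl fun y _ => ?_
  rw [Finset.mul_sum]
  refine Finset.sum_congr rfl fun o _ => ?_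
  -- Round `t` lies just beyond the domain of `y`, so taking the filler to be `o` encodes the
  -- outcome of round `t` in the same path.
  have h2 : {ω | Y ω = (y, o)} = {ω | ∀ s ∈ Finset.Icc 1 t, X s ω = extendPath y o s} := by
    ext ω
    simp only [Y, Set.mem_ofPred_eq, Prod.ext_iff, funext_iff]
    constructor
    · rintro ⟨h, h'⟩ s hs
      by_cases hst : s = t
      · rw [hst, extendPath_of_lt _ _ (by omega), h']
      · have hs' : s ∈ Finset.Icc 1 (t - 1) := by
          rw [Finset.mem_Icc] at hs ⊢; omega
        rw [extendPath_of_mem _ _ hs', ← h ⟨s, hs'⟩]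
    · intro h
      refine ⟨fun s => ?_, ?_⟩
      · have := Finset.mem_Icc.1 s.2
        rw [h s (Finset.mem_Icc.2 (by omega)), extendPath_of_mem]
      · rw [h t (Finset.mem_Icc.2 ⟨ht, le_rfl⟩), extendPath_of_lt _ _ (by omega)]
  rw [h2, hlaw, extendPath_of_lt _ _ (by omega), setOf_path_eq X y o, mul_assoc,
    show κ (extendPath y o) o = κ (extendPath y o₀) o from hκ o (hext y o o₀)]

end Paths

/-! ### Sums against product distributions. -/

section Products

variable {A : Type*} [Fintype A] {C : Type*} [Fintype C]

open Classical in
theorem sum_pi_prod (a : A → C → ℝ) : ∑ o : A → C, ∏ v, a v (o v) = ∏ v, ∑ c, a v c := by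
  rw [Finset.prod_univ_sum, Fintype.piFinset_univ]

open Classical in
/-- Marginals of a product distribution. -/
theorem sum_pi_prod_mul_apply {a : A → C → ℝ} (ha : ∀ v, ∑ c, a v c = 1) (φ : C → ℝ) (w : A) :
    ∑ o : A → C, (∏ v, a v (o v)) * φ (o w) = ∑ c, a w c * φ c := by
  have h := sum_pi_prod fun v c => if v = w then a v c * φ c else a v c
  have h1 : ∀ o : A → C, (∏ v, if v = w then a v (o v) * φ (o v) else a v (o v)) =
      (∏ v, a v (o v)) * φ (o w) := fun o => by
    rw [← Finset.mul_prod_erase _ _ (Finset.mem_univ w),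
      ← Finset.mul_prod_erase _ (fun v => a v (o v)) (Finset.mem_univ w), if_pos rfl,
      Finset.prod_congr rfl fun v hv => if_neg (Finset.ne_of_mem_erase hv)]
    ring
  simp only [h1] at h
  rw [h, ← Finset.mul_prod_erase _ _ (Finset.mem_univ w), Finset.prod_eq_one, mul_one]
  · simp
  · intro v hv
    simp [Finset.ne_of_mem_erase hv, ha]

end Products

end CoopInstance

/-! ### Which rounds the algorithm depends on. -/

namespace CoopInstance

open MeasureTheory

variable {A K : Type*} [Fintype A] [Fintype K] (P : CoopInstance A K)

/-- The sharp range `t - d - 1`, rather than `t - 1`, is what later allows conditioning on the past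
of a missing round while `p_t` stays fixed. -/
theorem prob_congr (η : ℝ) {x y : ℕ → RoundOutcome A K} (t : ℕ)
    (h : ∀ s ∈ Set.Icc 1 (t - P.d - 1), x s = y s) : P.prob η x t = P.prob η y t := by
  induction t using Nat.strong_induction_on with
  | _ t ih =>
    have hw : P.weight η x t = P.weight η y t := by
      ext i v
      simp only [weight]
      congr 2
      refine Finset.sum_congr rfl fun s hs => ?_
      rw [Finset.mem_Icc] at hs
      rw [ih s (by omega) fun r hr => h r ?_, h s hs]
      simp only [Set.mem_Icc] at hr ⊢
      omega
    ext i v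
    rw [prob_eq, prob_eq, hw]

theorem dependsOn_prob (η : ℝ) {s t : ℕ} (hst : s ≤ t) (i : K) (v : A) :
    DependsOn (fun x => P.prob η x s i v) (Set.Icc 1 (t - 1)) := fun x y h => by
  show P.prob η x s i v = P.prob η y s i v
  rw [P.prob_congr η s fun r hr => h r ?_]
  simp only [Set.mem_Icc] at hr ⊢
  omega

theorem dependsOn_lossEst (η : ℝ) {s t : ℕ} (hs : 1 ≤ s) (hst : s < t) (i : K) (v : A) :
    DependsOn (fun x => P.lossEst s (P.prob η x s) (x s) i v) (Set.Icc 1 (t - 1)) :=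
  fun x y h => by
  show P.lossEst s (P.prob η x s) (x s) i v = P.lossEst s (P.prob η y s) (y s) i v
  rw [P.prob_congr η s fun r hr => h r ?_, h s ⟨hs, by omega⟩]
  simp only [Set.mem_Icc] at hr ⊢
  omega

theorem Q_pos {A K : Type*} [Fintype A] [Nonempty A] (P : CoopInstance A K) : 0 < P.Q :=
  Finset.sum_pos (fun v _ => P.q_pos v) Finset.univ_nonempty

theorem B_nonneg (o : RoundOutcome A K) (i : K) (v : A) : 0 ≤ P.B o i v := by
  unfold B; split_ifs <;> norm_num

theorem B_sq (o : RoundOutcome A K) (i : K) (v : A) : P.B o i v ^ 2 = P.B o i v := by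
  unfold B; split_ifs <;> norm_num

/-! ### Inverse observation probabilities. -/

theorem one_sub_exp_neg_one_pos : 0 < 1 - Real.exp (-1) := by
  have := Real.exp_lt_exp.2 (show (-1 : ℝ) < 0 by norm_num)
  rw [Real.exp_zero] at this
  linarith

/-- With `s = ∑ x u`, the product is at most `exp (-s)`, and `1 - exp (-s)` is at least `(1 - exp
(-1)) * min s 1`, which dominates `(1 - exp (-1)) * (s / (1 + s))`. -/
theorem inv_one_sub_prod_le {ι : Type*} (S : Finset ι) (x : ι → ℝ) (hx1 : ∀ u ∈ S, x u ≤ 1)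
    (hs : 0 < ∑ u ∈ S, x u) :
    0 < 1 - ∏ u ∈ S, (1 - x u) ∧
      1 / (1 - ∏ u ∈ S, (1 - x u)) ≤ (1 / (∑ u ∈ S, x u) + 1) / (1 - Real.exp (-1)) := by
  set s := ∑ u ∈ S, x u with hs_def
  have hc := one_sub_exp_neg_one_pos
  have hprod : ∏ u ∈ S, (1 - x u) ≤ Real.exp (-s) := by
    rw [hs_def, ← Finset.sum_neg_distrib, Real.exp_sum]
    exact Finset.prod_le_prod (fun u hu => by linarith [hx1 u hu])
      fun u _ => Real.one_sub_le_exp_neg _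
  have hexp : (1 - Real.exp (-1)) * (s / (1 + s)) ≤ 1 - Real.exp (-s) := by
    rcases le_total s 1 with h | h
    -- On `[-1, 0]` the exponential lies below its chord.
    · have h1 := convexOn_exp.2 (Set.mem_univ (0 : ℝ)) (Set.mem_univ (-1 : ℝ))
        (sub_nonneg.2 h) hs.le (by ring)
      simp only [smul_eq_mul, mul_zero, zero_add, Real.exp_zero, mul_neg, mul_one] at h1
      have h2 : s / (1 + s) ≤ s := div_le_self hs.le (by linarith)
      nlinarith
    · have h1 : Real.exp (-s) ≤ Real.exp (-1) := Real.exp_le_exp.2 (by linarith)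
      have h2 : s / (1 + s) ≤ 1 := (div_le_one (by linarith)).2 (by linarith)
      nlinarith
  have hpos : 0 < (1 - Real.exp (-1)) * (s / (1 + s)) := by positivity
  refine ⟨by linarith, ?_⟩
  calc 1 / (1 - ∏ u ∈ S, (1 - x u)) ≤ 1 / ((1 - Real.exp (-1)) * (s / (1 + s))) :=
        one_div_le_one_div_of_le hpos (by linarith)
    _ = _ := by field_simp

section Distribution

variable {p : K → A → ℝ}

theorem b_pos_and_inv_b_le (hp : ∀ i v, 0 < p i v) (hp1 : ∀ v, ∑ i, p i v = 1) (i : K) (v : A) :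
    0 < P.b p i v ∧ 1 / P.b p i v ≤
      (1 / (∑ u ∈ P.N.closedNbhd P.n v, ∑ j ∈ P.F.closedNbhd P.f i, P.q u * p j u) + 1) /
        (1 - Real.exp (-1)) := by
  have h := inv_one_sub_prod_le (P.N.closedNbhd P.n v)
    (fun u => P.q u * ∑ j ∈ P.F.closedNbhd P.f i, p j u) (fun u _ => ?_) ?_
  · simpa only [b, Finset.mul_sum] using h
  · refine mul_le_one₀ (P.q_le_one u) (Finset.sum_nonneg fun j _ => (hp j u).le) ?_
    rw [← hp1 u]
    exact Finset.sum_le_sum_of_subset_of_nonneg (Finset.subset_univ _) fun j _ _ => (hp j u).le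
  · exact Finset.sum_pos (fun u _ => mul_pos (P.q_pos u) (Finset.sum_pos (fun j _ => hp j u)
      ⟨i, P.F.self_mem_closedNbhd _ i⟩)) ⟨v, P.N.self_mem_closedNbhd _ v⟩

/-- Caro–Wei with vertex weights `q v * p i v`, of total mass `Q`: the part `1 / s` of the bound on
`1 / b` sums to at most `alpha`, the constant part to `Q`. -/
theorem sum_div_b_le (hp : ∀ i v, 0 < p i v) (hp1 : ∀ v, ∑ i, p i v = 1) :
    ∑ v, P.q v * ∑ i, p i v * (1 / P.b p i v) ≤ (P.alpha + P.Q) / (1 - Real.exp (-1)) := by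
  classical
  set s : A × K → ℝ := fun x =>
    ∑ u ∈ P.N.closedNbhd P.n x.1, ∑ j ∈ P.F.closedNbhd P.f x.2, P.q u * p j u with hs
  set z : A × K → ℝ := fun x => P.q x.1 * p x.2 x.1 with hz
  have hz0 : ∀ x, 0 < z x := fun x => mul_pos (P.q_pos _) (hp _ _)
  have hα : ∑ x, z x / s x ≤ P.alpha := by
    refine le_trans (le_of_eq ?_) (SimpleGraph.sum_div_sum_closed_le_indepNum _ hz0)
    refine Finset.sum_congr rfl fun x _ => ?_
    congr 1
    simp only [hs]
    rw [← Finset.sum_product']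
    refine Finset.sum_congr ?_ fun _ _ => rfl
    ext y
    exact SimpleGraph.eq_or_adj_strongProd_distPower.symm.trans (by simp)
  have hQ : ∑ x, z x = P.Q := by
    rw [Fintype.sum_prod_type, Q]
    exact Finset.sum_congr rfl fun v _ => by simp only [hz, ← Finset.mul_sum, hp1, mul_one]
  calc ∑ v, P.q v * ∑ i, p i v * (1 / P.b p i v)
      = ∑ x : A × K, z x * (1 / P.b p x.2 x.1) := by
        simp only [Fintype.sum_prod_type, Finset.mul_sum, hz, mul_assoc]
    _ ≤ ∑ x : A × K, z x * ((1 / s x + 1) / (1 - Real.exp (-1))) :=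
        Finset.sum_le_sum fun x _ => mul_le_mul_of_nonneg_left
          (P.b_pos_and_inv_b_le hp hp1 x.2 x.1).2 (hz0 x).le
    _ = (∑ x, z x / s x + ∑ x, z x) / (1 - Real.exp (-1)) := by
        rw [← Finset.sum_add_distrib, Finset.sum_div]
        exact Finset.sum_congr rfl fun x _ => by ring
    _ ≤ _ := div_le_div_of_nonneg_right (by linarith) one_sub_exp_neg_one_pos.le

end Distribution

/-! ### Conditional expectations within one round. -/

section Step

variable [Nonempty K] (η : ℝ) (x : ℕ → RoundOutcome A K) (t : ℕ)

theorem sum_weight_pos (v : A) : 0 < ∑ j, P.weight η x t j v :=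
  Finset.sum_pos (fun _ _ => Real.exp_pos _) Finset.univ_nonempty

theorem prob_pos (i : K) (v : A) : 0 < P.prob η x t i v := by
  rw [prob_eq]
  exact div_pos (Real.exp_pos _) (P.sum_weight_pos η x t v)

theorem sum_prob (v : A) : ∑ i, P.prob η x t i v = 1 := by
  simp only [prob_eq]
  rw [← Finset.sum_div, div_self (P.sum_weight_pos η x t v).ne']

theorem b_prob_pos (i : K) (v : A) : 0 < P.b (P.prob η x t) i v :=
  (P.b_pos_and_inv_b_le (P.prob_pos η x t) (P.sum_prob η x t) i v).1

theorem lossEst_nonneg (s : ℕ) (o : RoundOutcome A K) (i : K) (v : A) :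
    0 ≤ P.lossEst s (P.prob η x t) o i v :=
  div_nonneg (mul_nonneg (P.loss_nonneg s i) (P.B_nonneg o i v)) (P.b_prob_pos η x t i v).le

theorem sum_agentProb (v : A) : ∑ c, P.agentProb η x t v c = 1 := by
  simp [Fintype.sum_option, agentProb, ← Finset.mul_sum, sum_prob]

/-- The probability of the outcome `o` in round `t`, given the outcomes `x` of the earlier
rounds. -/
noncomputable def outcomeProb (o : RoundOutcome A K) : ℝ := ∏ v, P.agentProb η x t v (o v)

open Classical in
theorem sum_outcomeProb : ∑ o, P.outcomeProb η x t o = 1 := by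
  simp only [outcomeProb]
  rw [sum_pi_prod, Finset.prod_eq_one fun v _ => P.sum_agentProb η x t v]

-- `1 - B` is a product over agents of indicators that the agent is out of range, inactive, or plays
-- outside the neighborhood of `i`; independence factors its expectation.
open Classical in
theorem sum_outcomeProb_mul_B (i : K) (v : A) :
    ∑ o, P.outcomeProb η x t o * P.B o i v = P.b (P.prob η x t) i v := by
  let φ : A → Option K → ℝ := fun u c => if u ∈ P.N.closedNbhd P.n v then
    (c.elim 1 fun j => if j ∈ P.F.closedNbhd P.f i then 0 else 1) else 1
  have hB : ∀ o, P.B o i v = 1 - ∏ u, φ u (o u) := by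
    intro o
    unfold B
    split_ifs with h
    · obtain ⟨u, hu, j, hj, huj⟩ := h
      rw [Finset.prod_eq_zero (Finset.mem_univ u) (by simp [φ, hu, huj, hj]), sub_zero]
    · rw [Finset.prod_eq_one, sub_self]
      intro u _
      simp only [φ]
      split_ifs with hu
      · cases hc : o u with
        | none => rfl
        | some j => exact if_neg fun hj => h ⟨u, hu, j, hj, hc⟩
      · rfl
  have hφ : ∀ u, ∑ c, P.agentProb η x t u c * φ u c = if u ∈ P.N.closedNbhd P.n v then
      1 - P.q u * ∑ j ∈ P.F.closedNbhd P.f i, P.prob η x t j u else 1 := by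
    intro u
    by_cases hu : u ∈ P.N.closedNbhd P.n v
    · have h1 := P.sum_prob η x t u
      rw [← Finset.sum_filter_add_sum_filter_not _ (· ∈ P.F.closedNbhd P.f i),
        Finset.filter_univ_mem] at h1
      simp only [φ, hu, if_true, Fintype.sum_option, agentProb, Option.elim, mul_ite, mul_zero,
        mul_one]
      have h2 : ∑ j, (if j ∈ P.F.closedNbhd P.f i then 0 else P.q u * P.prob η x t j u) =
          P.q u * ∑ j with j ∉ P.F.closedNbhd P.f i, P.prob η x t j u := by
        rw [Finset.mul_sum, Finset.sum_filter]
        exact Finset.sum_congr rfl fun j _ => by split_ifs <;> rfl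
      rw [h2, eq_sub_of_add_eq' h1]
      ring
    · simp only [φ, hu, if_false, mul_one, sum_agentProb]
  simp only [hB, mul_sub, mul_one, Finset.sum_sub_distrib, sum_outcomeProb]
  simp only [outcomeProb, ← Finset.prod_mul_distrib]
  rw [sum_pi_prod fun u c => P.agentProb η x t u c * φ u c]
  simp only [hφ, b]
  rw [Finset.prod_ite_mem, Finset.univ_inter]

open Classical in
theorem sum_outcomeProb_mul_lossEst (i : K) (v : A) :
    ∑ o, P.outcomeProb η x t o * P.lossEst t (P.prob η x t) o i v = P.loss t i := by
  have h : ∀ o, P.outcomeProb η x t o * P.lossEst t (P.prob η x t) o i v =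
      P.outcomeProb η x t o * P.B o i v * (P.loss t i / P.b (P.prob η x t) i v) := fun o => by
    rw [lossEst]; ring
  simp only [h]
  rw [← Finset.sum_mul, sum_outcomeProb_mul_B, mul_div_cancel₀ _ (P.b_prob_pos η x t i v).ne']

-- Since `B ^ 2 = B`, one of the two factors `1 / b` cancels against the expectation `b` of `B`.
open Classical in
theorem sum_outcomeProb_mul_lossEst_sq_le (i : K) (v : A) :
    ∑ o, P.outcomeProb η x t o * P.lossEst t (P.prob η x t) o i v ^ 2 ≤
      1 / P.b (P.prob η x t) i v := by
  have hb := P.b_prob_pos η x t i v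
  have h : ∀ o, P.outcomeProb η x t o * P.lossEst t (P.prob η x t) o i v ^ 2 =
      P.outcomeProb η x t o * P.B o i v * (P.loss t i / P.b (P.prob η x t) i v) ^ 2 := fun o => by
    rw [lossEst, div_pow, mul_pow, B_sq]; ring
  simp only [h]
  rw [← Finset.sum_mul, sum_outcomeProb_mul_B, div_pow, sq (P.b _ i v), mul_div_assoc',
    mul_div_mul_left _ _ hb.ne']
  exact div_le_div_of_nonneg_right (pow_le_one₀ (P.loss_nonneg t i) (P.loss_le_one t i)) hb.le

theorem activeLoss_sub_eq {A K : Type*} [Fintype A] (P : CoopInstance A K) (t : ℕ)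
    (o : RoundOutcome A K) (k : K) :
    P.activeLoss t o - ((Finset.univ.filter fun v => (o v).isSome).card : ℝ) * P.loss t k =
      ∑ v, (o v).elim 0 fun i => P.loss t i - P.loss t k := by
  rw [activeLoss, Finset.card_filter, Nat.cast_sum, Finset.sum_mul, ← Finset.sum_sub_distrib]
  refine Finset.sum_congr rfl fun v _ => ?_
  cases o v <;> simp

/-- The expected regret of round `t` against the action `k`, given the earlier rounds. -/
noncomputable def roundRegret (k : K) : ℝ :=
  ∑ v, P.q v * (∑ i, P.prob η x t i v * P.loss t i - P.loss t k)

open Classical in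
theorem sum_outcomeProb_mul_activeLoss_sub (k : K) :
    ∑ o, P.outcomeProb η x t o * (P.activeLoss t o -
      ((Finset.univ.filter fun v => (o v).isSome).card : ℝ) * P.loss t k) =
      P.roundRegret η x t k := by
  simp only [activeLoss_sub_eq, Finset.mul_sum]
  rw [Finset.sum_comm]
  refine Finset.sum_congr rfl fun v _ => ?_
  simp only [outcomeProb]
  rw [sum_pi_prod_mul_apply (fun v => P.sum_agentProb η x t v)
    (fun c => c.elim 0 fun i => P.loss t i - P.loss t k) v]
  simp only [Fintype.sum_option, agentProb, Option.elim, mul_zero, zero_add, mul_assoc,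
    ← Finset.mul_sum, mul_sub, Finset.sum_sub_distrib, ← Finset.sum_mul, sum_prob, one_mul]

theorem roundRegret_le (k : K) : P.roundRegret η x t k ≤ P.Q := by
  refine Finset.sum_le_sum fun v _ => mul_le_of_le_one_right (P.q_pos v).le ?_
  have : ∑ i, P.prob η x t i v * P.loss t i ≤ ∑ i, P.prob η x t i v :=
    Finset.sum_le_sum fun i _ => mul_le_of_le_one_right (P.prob_pos η x t i v).le
      (P.loss_le_one t i)
  rw [sum_prob] at this
  linarith [P.loss_nonneg t k]

theorem roundRegret_of_subsingleton [Subsingleton K] (k : K) : P.roundRegret η x t k = 0 := by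
  refine Finset.sum_eq_zero fun v _ => ?_
  have h : ∀ i, P.prob η x t i v * P.loss t i = P.prob η x t i v * P.loss t k := fun i => by
    rw [Subsingleton.elim i k]
  simp only [h]
  rw [← Finset.sum_mul, sum_prob, one_mul, sub_self, mul_zero]

theorem sum_q_mul_sum_prob_mul_loss_le (s : ℕ) :
    ∑ v, P.q v * ∑ i, P.prob η x t i v * P.loss s i ≤ P.Q := by
  refine Finset.sum_le_sum fun v _ => mul_le_of_le_one_right (P.q_pos v).le ?_
  rw [← P.sum_prob η x t v]
  exact Finset.sum_le_sum fun i _ => mul_le_of_le_one_right (P.prob_pos η x t i v).le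
    (P.loss_le_one s i)

end Step

end CoopInstance

/-! ### Expectations along a run and the regret bound. -/

namespace CoopInstance

open MeasureTheory

section Run

variable {A K Ω : Type*} [Fintype A] [Fintype K] [MeasurableSpace Ω] {μ : Measure Ω}
  {P : CoopInstance A K} {η : ℝ} {X : ℕ → Ω → RoundOutcome A K}

open Classical in
/-- The expectation of a function of the outcomes of the rounds `1, …, T`. -/
noncomputable def runExpect (μ : Measure Ω) (X : ℕ → Ω → RoundOutcome A K) (T : ℕ) :
    ((ℕ → RoundOutcome A K) → ℝ) →ₗ[ℝ] ℝ :=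
  pathExpect μ X (fun _ => none) T

open Classical in
theorem runExpect_mono {T : ℕ} {g h : (ℕ → RoundOutcome A K) → ℝ} (hgh : ∀ x, g x ≤ h x) :
    runExpect μ X T g ≤ runExpect μ X T h :=
  pathExpect_mono μ X _ T hgh

variable [IsProbabilityMeasure μ]

open Classical in
theorem IsRun.runExpect_le (hX : P.IsRun η X μ) {T : ℕ} {g : (ℕ → RoundOutcome A K) → ℝ} {c : ℝ}
    (hg : ∀ x, g x ≤ c) : runExpect μ X T g ≤ c :=
  (runExpect_mono hg).trans_eq (pathExpect_const μ hX.measurableSet_eq (fun _ => none) T c)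

open Classical in
/-- Conditioning on the rounds before `t`. -/
theorem IsRun.runExpect_eq (hX : P.IsRun η X μ) {t T : ℕ} (ht : t ∈ Finset.Icc 1 T)
    {G : (ℕ → RoundOutcome A K) → RoundOutcome A K → ℝ}
    (hG : ∀ o, DependsOn (fun x => G x o) (Set.Icc 1 (t - 1))) :
    runExpect μ X T (fun x => G x (x t)) =
      runExpect μ X T (fun x => ∑ o, P.outcomeProb η x t o * G x o) := by
  rw [Finset.mem_Icc] at ht
  have hκ : ∀ o, DependsOn (fun x => P.outcomeProb η x t o) (Set.Icc 1 (t - 1)) := by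
    intro o x y h
    refine Finset.prod_congr rfl fun v _ => ?_
    cases o v with
    | none => rfl
    | some i => exact congrArg (P.q v * ·) (P.dependsOn_prob η le_rfl i v h)
  have hsub : Set.Icc 1 (t - 1) ⊆ Set.Icc 1 T := Set.Icc_subset_Icc_right (by omega)
  have h := integral_eq_integral_sum_transition μ hX.measurableSet_eq ht.1
    (κ := fun x o => P.outcomeProb η x t o) hκ (hX.law t ht.1) hG
  rw [integral_eq_pathExpect μ hX.measurableSet_eq (fun _ => none) T (g := fun x => G x (x t)),
    integral_eq_pathExpect μ hX.measurableSet_eq (fun _ => none) T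
      (g := fun x => ∑ o, P.outcomeProb η x t o * G x o)] at h
  · exact h
  · intro x y hxy
    exact Finset.sum_congr rfl fun o _ => congrArg₂ _ (hκ o fun s hs => hxy s (hsub hs))
      (hG o fun s hs => hxy s (hsub hs))
  · intro x y hxy
    show G x (x t) = G y (y t)
    rw [hxy t ht]
    exact hG _ fun s hs => hxy s (hsub hs)

-- The coefficients `β` are fixed by the earlier rounds, so only the estimate is averaged over round
-- `t`. Used with `φ` the identity and the square.
open Classical in
theorem IsRun.runExpect_sum_mul (hX : P.IsRun η X μ) {t T : ℕ} (ht : t ∈ Finset.Icc 1 T)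
    {β : (ℕ → RoundOutcome A K) → K → A → ℝ}
    (hβ : ∀ i v, DependsOn (fun x => β x i v) (Set.Icc 1 (t - 1))) (φ : ℝ → ℝ) :
    runExpect μ X T (fun x => ∑ v, P.q v * ∑ i, β x i v *
        φ (P.lossEst t (P.prob η x t) (x t) i v)) =
      runExpect μ X T (fun x => ∑ v, P.q v * ∑ i, β x i v *
        ∑ o, P.outcomeProb η x t o * φ (P.lossEst t (P.prob η x t) o i v)) := by
  rw [hX.runExpect_eq ht (G := fun x o => ∑ v, P.q v * ∑ i, β x i v *
        φ (P.lossEst t (P.prob η x t) o i v))]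
  · congr 1
    ext x
    simp only [Finset.mul_sum]
    rw [Finset.sum_comm]
    refine Finset.sum_congr rfl fun v _ => ?_
    rw [Finset.sum_comm]
    exact Finset.sum_congr rfl fun i _ => Finset.sum_congr rfl fun o _ => by ring
  · intro o x y h
    refine Finset.sum_congr rfl fun v _ => congrArg _ (Finset.sum_congr rfl fun i _ => ?_)
    have h1 : P.prob η x t = P.prob η y t := by
      ext i v
      exact P.dependsOn_prob η le_rfl i v h
    show β x i v * _ = β y i v * _
    rw [show β x i v = β y i v from hβ i v h, h1]

variable [Nonempty K]

theorem IsRun.runExpect_sum_mul_lossEst (hX : P.IsRun η X μ) {t T : ℕ} (ht : t ∈ Finset.Icc 1 T)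
    {β : (ℕ → RoundOutcome A K) → K → A → ℝ}
    (hβ : ∀ i v, DependsOn (fun x => β x i v) (Set.Icc 1 (t - 1))) :
    runExpect μ X T (fun x => ∑ v, P.q v * ∑ i, β x i v *
        P.lossEst t (P.prob η x t) (x t) i v) =
      runExpect μ X T (fun x => ∑ v, P.q v * ∑ i, β x i v * P.loss t i) := by
  classical
  have := hX.runExpect_sum_mul ht hβ id
  simpa only [id, sum_outcomeProb_mul_lossEst] using this

theorem IsRun.runExpect_lossEst_sq_le (hX : P.IsRun η X μ) {t T : ℕ} (ht : t ∈ Finset.Icc 1 T) :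
    runExpect μ X T (fun x => ∑ v, P.q v * ∑ i, P.prob η x t i v *
        P.lossEst t (P.prob η x t) (x t) i v ^ 2) ≤
      (P.alpha + P.Q) / (1 - Real.exp (-1)) := by
  classical
  rw [hX.runExpect_sum_mul ht (P.dependsOn_prob η le_rfl) (· ^ 2)]
  refine hX.runExpect_le fun x => le_trans ?_
    (P.sum_div_b_le (P.prob_pos η x t) (P.sum_prob η x t))
  exact Finset.sum_le_sum fun v _ => mul_le_mul_of_nonneg_left (Finset.sum_le_sum fun i _ =>
    mul_le_mul_of_nonneg_left (P.sum_outcomeProb_mul_lossEst_sq_le η x t i v)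
      (P.prob_pos η x t i v).le) (P.q_pos v).le

/-- Averaging over round `t` first replaces its estimate by a loss at most 1. Each missing estimate
is then averaged over its own round `s`. -/
theorem IsRun.runExpect_lossEst_mul_sum_le (hX : P.IsRun η X μ) {t T : ℕ}
    (ht : t ∈ Finset.Icc 1 T) :
    runExpect μ X T (fun x => ∑ v, P.q v * ∑ i, P.prob η x t i v *
        (P.lossEst t (P.prob η x t) (x t) i v *
          ∑ s ∈ Finset.Ioc (t - P.d - 1) (t - 1), P.lossEst s (P.prob η x s) (x s) i v)) ≤
      P.d * P.Q := by
  have ht' := Finset.mem_Icc.1 ht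
  have hS : ∀ s ∈ Finset.Ioc (t - P.d - 1) (t - 1), 1 ≤ s ∧ s < t ∧ t - P.d - 1 ≤ s - 1 := by
    intro s hs
    rw [Finset.mem_Ioc] at hs
    omega
  set S := Finset.Ioc (t - P.d - 1) (t - 1)
  have hcard : (S.card : ℝ) ≤ P.d := by
    rw [Nat.card_Ioc]
    exact_mod_cast (by omega : t - 1 - (t - P.d - 1) ≤ P.d)
  set e : (ℕ → RoundOutcome A K) → ℕ → K → A → ℝ :=
    fun x s => P.lossEst s (P.prob η x s) (x s) with he
  have he0 : ∀ x s i v, 0 ≤ e x s i v := fun x s i v => P.lossEst_nonneg η x s s _ i v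
  have h1 := hX.runExpect_sum_mul_lossEst ht
    (β := fun x i v => P.prob η x t i v * ∑ s ∈ S, e x s i v) fun i v x y h =>
      congrArg₂ _ (P.dependsOn_prob η le_rfl i v h)
        (Finset.sum_congr rfl fun s hs => P.dependsOn_lossEst η (hS s hs).1 (hS s hs).2.1 i v h)
  have h2 : ∀ s ∈ S, runExpect μ X T (fun x => ∑ v, P.q v * ∑ i, P.prob η x t i v *
      e x s i v) ≤ P.Q := by
    intro s hs
    rw [hX.runExpect_sum_mul_lossEst (t := s) (β := fun x => P.prob η x t)]
    · exact hX.runExpect_le fun x => P.sum_q_mul_sum_prob_mul_loss_le η x t s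
    · exact Finset.mem_Icc.2 ⟨(hS s hs).1, by have := hS s hs; omega⟩
    -- `p_t` sees only rounds up to `t - d - 1 ≤ s - 1`, so it is a legitimate coefficient when
    -- conditioning before round `s`.
    · intro i v x y h
      show P.prob η x t i v = P.prob η y t i v
      rw [P.prob_congr η t fun r hr => h r (Set.Icc_subset_Icc_right (hS s hs).2.2 hr)]
  calc _ = runExpect μ X T (fun x => ∑ v, P.q v * ∑ i,
          P.prob η x t i v * (∑ s ∈ S, e x s i v) * P.loss t i) := by
        rw [← h1]
        congr 1
        ext x
        simp only [mul_comm, mul_left_comm, he]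
    _ ≤ runExpect μ X T (∑ s ∈ S, fun x => ∑ v, P.q v * ∑ i, P.prob η x t i v * e x s i v) := by
        refine runExpect_mono fun x => ?_
        rw [Finset.sum_apply, Finset.sum_comm]
        refine Finset.sum_le_sum fun v _ => ?_
        rw [← Finset.mul_sum, Finset.sum_comm]
        refine mul_le_mul_of_nonneg_left (Finset.sum_le_sum fun i _ => ?_) (P.q_pos v).le
        rw [← Finset.mul_sum]
        exact mul_le_of_le_one_right (mul_nonneg (P.prob_pos η x t i v).le
          (Finset.sum_nonneg fun s _ => he0 x s i v)) (P.loss_le_one t i)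
    _ ≤ ∑ _s ∈ S, P.Q := by
        rw [map_sum]
        exact Finset.sum_le_sum h2
    _ ≤ P.d * P.Q := by
        rw [Finset.sum_const, nsmul_eq_mul]
        exact mul_le_mul_of_nonneg_right hcard (Finset.sum_nonneg fun v _ => (P.q_pos v).le)

theorem IsRun.regret_eq (hX : P.IsRun η X μ) (T : ℕ) :
    P.regret X μ T = ⨆ k, ∑ t ∈ Finset.Icc 1 T,
      runExpect μ X T (fun x => P.roundRegret η x t k) := by
  classical
  refine iSup_congr fun k => ?_
  let g : ℕ → RoundOutcome A K → ℝ := fun t o => P.activeLoss t o -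
      ((Finset.univ.filter fun v => (o v).isSome).card : ℝ) * P.loss t k
  have h1 : DependsOn (fun x : ℕ → RoundOutcome A K => ∑ t ∈ Finset.Icc 1 T, g t (x t))
      (Set.Icc 1 T) := fun x y h =>
    Finset.sum_congr rfl fun t ht => congrArg _ (h t (Finset.mem_Icc.1 ht))
  have h2 := integral_eq_pathExpect μ hX.measurableSet_eq (fun _ => none) T h1
  simp only [g, Finset.sum_sub_distrib] at h2
  refine h2.trans ?_
  have h3 : (fun x : ℕ → RoundOutcome A K => ∑ t ∈ Finset.Icc 1 T, P.activeLoss t (x t) -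
      ∑ t ∈ Finset.Icc 1 T,
        ((Finset.univ.filter fun v => (x t v).isSome).card : ℝ) * P.loss t k) =
      ∑ t ∈ Finset.Icc 1 T, fun x => g t (x t) := by
    ext x
    rw [Finset.sum_apply, ← Finset.sum_sub_distrib]
  rw [h3, map_sum]
  refine Finset.sum_congr rfl fun t ht => ?_
  refine (hX.runExpect_eq ht (G := fun _ o => g t o) fun _ _ _ _ => rfl).trans ?_
  congr 1
  ext x
  exact P.sum_outcomeProb_mul_activeLoss_sub η x t k

theorem IsRun.regret_le_mul (hX : P.IsRun η X μ) (T : ℕ) : P.regret X μ T ≤ T * P.Q := by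
  rw [hX.regret_eq]
  refine ciSup_le fun k => (Finset.sum_le_sum fun t _ =>
    hX.runExpect_le fun x => P.roundRegret_le η x t k).trans ?_
  simp

theorem IsRun.regret_of_subsingleton (hX : P.IsRun η X μ) [Subsingleton K] (T : ℕ) :
    P.regret X μ T = 0 := by
  rw [hX.regret_eq]
  have h : runExpect μ X T (fun _ => 0) = 0 := (runExpect μ X T).map_zero
  simp only [roundRegret_of_subsingleton, h, Finset.sum_const_zero, ciSup_const]

/-- Slightly sharper than the final bound: there is no additive `d`, and the second-moment term
keeps its factor `1 / 2`. -/
theorem IsRun.regret_le (hX : P.IsRun η X μ) (hη : 0 < η) (T : ℕ) :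
    P.regret X μ T ≤ P.Q * (Real.log (Fintype.card K) / η) +
      T * (η / 2 * ((P.alpha + P.Q) / (1 - Real.exp (-1))) + η * (P.d * P.Q)) := by
  classical
  rw [hX.regret_eq]
  refine ciSup_le fun k => ?_
  let e : (ℕ → RoundOutcome A K) → ℕ → K → A → ℝ :=
    fun x s => P.lossEst s (P.prob η x s) (x s)
  have h1 : ∀ t ∈ Finset.Icc 1 T, runExpect μ X T (fun x => P.roundRegret η x t k) =
      runExpect μ X T (fun x => ∑ v, P.q v * (∑ i, P.prob η x t i v * e x t i v - e x t k v)) := by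
    intro t ht
    -- Taking `β` to be `p_t` minus the point mass at `k` replaces both losses in the regret by
    -- estimates at once.
    have h := hX.runExpect_sum_mul_lossEst ht
      (β := fun x i v => P.prob η x t i v - if i = k then 1 else 0) fun i v x y h =>
        congrArg (· - _) (P.dependsOn_prob η le_rfl i v h)
    simp only [sub_mul, ite_mul, one_mul, zero_mul, Finset.sum_sub_distrib, Finset.sum_ite_eq',
      Finset.mem_univ, if_true] at h
    exact h.symm
  let sq : ℕ → (ℕ → RoundOutcome A K) → ℝ := fun t x =>
    ∑ v, P.q v * ∑ i, P.prob η x t i v * e x t i v ^ 2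
  let cross : ℕ → (ℕ → RoundOutcome A K) → ℝ := fun t x =>
    ∑ v, P.q v * ∑ i, P.prob η x t i v * (e x t i v *
      ∑ s ∈ Finset.Ioc (t - P.d - 1) (t - 1), e x s i v)
  rw [Finset.sum_congr rfl h1, ← map_sum]
  calc _ ≤ runExpect μ X T ((fun _ => P.Q * (Real.log (Fintype.card K) / η)) +
        ∑ t ∈ Finset.Icc 1 T, ((η / 2) • sq t + η • cross t)) := by
        refine runExpect_mono fun x => ?_
        simp only [Finset.sum_apply, Pi.add_apply, Pi.smul_apply, smul_eq_mul, sq, cross]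
        have h2 : ∀ v, _ := fun v => expWeights_delayed_regret_le hη P.d (fun t i => e x t i v)
          (fun t i => P.lossEst_nonneg η x t t _ i v) (fun t i => P.prob η x t i v)
          (fun t i => P.prob_eq η x t i v) T k
        have h3 := Finset.sum_le_sum fun v (_ : v ∈ Finset.univ) =>
          mul_le_mul_of_nonneg_left (h2 v) (P.q_pos v).le
        refine le_trans (le_of_eq ?_) (h3.trans (le_of_eq ?_))
        · rw [Finset.sum_comm]
          simp only [Finset.mul_sum]
        · simp only [mul_add, Finset.sum_add_distrib, ← Finset.sum_mul, Q, Finset.mul_sum]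
          congr 2
          · rw [Finset.sum_comm]
            simp only [mul_left_comm]
          · rw [Finset.sum_comm]
            simp only [mul_left_comm]
    _ ≤ P.Q * (Real.log (Fintype.card K) / η) + ∑ t ∈ Finset.Icc 1 T,
        (η / 2 * ((P.alpha + P.Q) / (1 - Real.exp (-1))) + η * (P.d * P.Q)) := by
        rw [map_add, map_sum]
        refine add_le_add (hX.runExpect_le fun _ => le_rfl) (Finset.sum_le_sum fun t ht => ?_)
        rw [map_add, map_smul, map_smul, smul_eq_mul, smul_eq_mul]
        exact add_le_add
          (mul_le_mul_of_nonneg_left (hX.runExpect_lossEst_sq_le ht) (by positivity))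
          (mul_le_mul_of_nonneg_left (hX.runExpect_lossEst_mul_sum_le ht) hη.le)
    _ = _ := by simp [mul_add]

end Run

/-! ### Tuning the learning rate. -/

/-- Lets the `+ 1` in the learning rate be absorbed. If `n = 0`, the zeroth power of `N` has no
edges, so the copy of `A` over one action is independent and `alpha ≥ |A| ≥ Q`; otherwise `d ≥ 1`.
-/
theorem one_le_alpha_div_Q_add_d {A K : Type*} [Fintype A] [Nonempty A] [Fintype K] [Nonempty K]
    (P : CoopInstance A K) : 1 ≤ P.alpha / P.Q + P.d := by
  classical
  have hα : 0 ≤ P.alpha / P.Q := div_nonneg (Nat.cast_nonneg _) P.Q_pos.le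
  by_cases hn : P.n = 0
  · obtain ⟨k⟩ := ‹Nonempty K›
    have hI : ((P.N.distPower P.n).strongProd (P.F.distPower P.f)).IsIndepSet
        ((Finset.univ.map ⟨fun v : A => (v, k), fun v w h => (Prod.ext_iff.1 h).1⟩ :
          Finset (A × K)) : Set (A × K)) := by
      intro x hx y hy hxy hadj
      simp only [Finset.coe_map, Set.mem_image] at hx hy
      obtain ⟨v, -, rfl⟩ := hx
      obtain ⟨w, -, rfl⟩ := hy
      rcases hadj.2.1 with h | h
      · exact hxy (Prod.ext h rfl)
      · have h2 := h.2
        rw [hn] at h2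
        simp only [Nat.cast_zero, nonpos_iff_eq_zero, SimpleGraph.edist_eq_zero_iff] at h2
        exact h.1 h2
    have h1 := hI.card_le_indepNum
    rw [Finset.card_map] at h1
    have h2 : P.Q ≤ P.alpha := by
      calc P.Q ≤ ∑ _v : A, (1 : ℝ) := Finset.sum_le_sum fun v _ => P.q_le_one v
        _ = (Finset.univ : Finset A).card := by simp
        _ ≤ P.alpha := by exact_mod_cast h1
    have h3 : 1 ≤ P.alpha / P.Q := (one_le_div P.Q_pos).2 h2
    have h4 : (0 : ℝ) ≤ P.d := Nat.cast_nonneg _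
    linarith
  · have : (1 : ℝ) ≤ P.d := by
      have : 1 ≤ P.d := by unfold d; omega
      exact_mod_cast this
    linarith

theorem IsRun.regret_div_Q_le {A K Ω : Type*} [Fintype A] [Nonempty A] [Fintype K] [Nonempty K]
    [MeasurableSpace Ω] {μ : Measure Ω} [IsProbabilityMeasure μ] {P : CoopInstance A K} {η : ℝ}
    {X : ℕ → Ω → RoundOutcome A K} (hX : P.IsRun η X μ) (hη : 0 < η) (T : ℕ) :
    P.regret X μ T / P.Q ≤ P.d + Real.log (Fintype.card K) / η +
      η * T * ((P.alpha / P.Q + 1) / (1 - Real.exp (-1)) + P.d) := by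
  have hQ := P.Q_pos
  have hc := one_sub_exp_neg_one_pos
  rw [div_le_iff₀ hQ]
  refine (hX.regret_le hη T).trans ?_
  have h1 : (P.alpha + P.Q) / (1 - Real.exp (-1)) =
      P.Q * ((P.alpha / P.Q + 1) / (1 - Real.exp (-1))) := by
    field_simp
  have h2 : 0 ≤ (P.alpha / P.Q + 1) / (1 - Real.exp (-1)) := by positivity
  rw [h1]
  set a := (P.alpha / P.Q + 1) / (1 - Real.exp (-1))
  have h3 : 0 ≤ P.d * P.Q := by positivity
  have h4 : 0 ≤ η * T * a * P.Q := by positivity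
  nlinarith

theorem IsRun.regret_div_Q_le_sqrt {A K Ω : Type*} [Fintype A] [Nonempty A] [Fintype K]
    [Nonempty K] [MeasurableSpace Ω] {μ : Measure Ω} [IsProbabilityMeasure μ]
    {P : CoopInstance A K} {η : ℝ} {X : ℕ → Ω → RoundOutcome A K} (hX : P.IsRun η X μ) {T : ℕ}
    (hT : 1 ≤ T) (hη : η = √(Real.log (Fintype.card K) / (T * (P.alpha / P.Q + P.d + 1)))) :
    P.regret X μ T / P.Q ≤
      8 * √(Real.log (Fintype.card K) * (P.alpha / P.Q + P.d) * T) := by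
  -- With a single action `η = 0`, so the general bound does not apply, but the regret vanishes.
  rcases subsingleton_or_nontrivial K with hK | hK
  · rw [hX.regret_of_subsingleton, zero_div]
    positivity
  have hQ := P.Q_pos
  have hS := P.one_le_alpha_div_Q_add_d
  have hα : 0 ≤ P.alpha / P.Q := by positivity
  have hT1 : (1 : ℝ) ≤ T := by exact_mod_cast hT
  have hL : 1 / 4 ≤ Real.log (Fintype.card K) := by
    have h2 : (2 : ℝ) ≤ Fintype.card K := by exact_mod_cast Fintype.one_lt_card
    have := Real.log_le_log (by norm_num) h2
    linarith [Real.log_two_gt_d9]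
  set L := Real.log (Fintype.card K)
  set a := (P.alpha : ℝ) / P.Q
  set d := (P.d : ℝ)
  have hd : 0 ≤ d := Nat.cast_nonneg _
  set R := √(L * (a + d) * T) with hR
  have hR0 : 0 ≤ R := Real.sqrt_nonneg _
  have hRsq : R ^ 2 = L * (a + d) * T := Real.sq_sqrt (by positivity)
  have hdT : d * T ≤ (2 * R) ^ 2 := by
    rw [mul_pow, hRsq]
    have : d * T ≤ (a + d) * T := by nlinarith
    nlinarith [mul_nonneg (by linarith : 0 ≤ a + d) (by linarith : (0 : ℝ) ≤ T)]
  -- From `d * T ≤ (2 * R) ^ 2`, the smaller of `d` and `T` is at most `2 * R`. If it is `d`, the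
  -- three terms are at most `2 * R`, `2 * R` and `4 * R`, whence the constant 8; if it is `T`, the
  -- trivial bound `T` suffices.
  rcases le_total d T with h | h
  · have hd2 : d ≤ 2 * R := abs_le_of_sq_le_sq' (by nlinarith) (by linarith) |>.2
    have hL0 : 0 < L := by linarith
    have hη0 : 0 < η := by rw [hη]; exact Real.sqrt_pos.2 (by positivity)
    have hηsq : η ^ 2 * (T * (a + d + 1)) = L := by
      rw [hη, Real.sq_sqrt (by positivity)]
      field_simp
    have hLη : L / η = η * (T * (a + d + 1)) := by
      rw [div_eq_iff hη0.ne', ← hηsq]; ring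
    have hηR : η * (T * (a + d + 1)) ≤ 2 * R := by
      refine (abs_le_of_sq_le_sq' ?_ (by linarith)).2
      calc (η * (T * (a + d + 1))) ^ 2 = η ^ 2 * (T * (a + d + 1)) * (T * (a + d + 1)) := by ring
        _ = L * (T * (a + d + 1)) := by rw [hηsq]
        _ ≤ L * (T * (4 * (a + d))) := by gcongr; linarith
        _ = (2 * R) ^ 2 := by rw [mul_pow, hRsq]; ring
    have he : 1 / 2 ≤ 1 - Real.exp (-1) := by
      have := Real.exp_neg_one_lt_d9
      linarith
    have hfrac : (a + 1) / (1 - Real.exp (-1)) + d ≤ 2 * (a + d + 1) := by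
      have : (a + 1) / (1 - Real.exp (-1)) ≤ 2 * (a + 1) := by
        rw [div_le_iff₀ (by linarith)]
        nlinarith
      linarith
    have h1 := hX.regret_div_Q_le hη0 T
    have h2 : η * T * ((a + 1) / (1 - Real.exp (-1)) + d) ≤ η * T * (2 * (a + d + 1)) :=
      mul_le_mul_of_nonneg_left hfrac (by positivity)
    calc _ ≤ d + L / η + η * T * ((a + 1) / (1 - Real.exp (-1)) + d) := h1
      _ ≤ d + η * (T * (a + d + 1)) + 2 * (η * (T * (a + d + 1))) := by rw [hLη]; linarith
      _ ≤ 8 * R := by linarith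
  · have h1 : P.regret X μ T / P.Q ≤ T := (div_le_iff₀ hQ).2 (hX.regret_le_mul T)
    have h2 : (T : ℝ) ≤ 2 * R := (abs_le_of_sq_le_sq' (by nlinarith) (by linarith)).2
    linarith

end CoopInstance

theorem theorem1 :
    (∀ {A K Ω : Type*} [Fintype A] [Nonempty A] [Fintype K] [Nonempty K] [MeasurableSpace Ω]
        (μ : MeasureTheory.Measure Ω) [MeasureTheory.IsProbabilityMeasure μ]
        (P : CoopInstance A K) (η : ℝ) (X : ℕ → Ω → RoundOutcome A K) (T : ℕ),
        0 < η → P.IsRun η X μ →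
        P.regret X μ T / P.Q ≤
          P.d + Real.log (Fintype.card K) / η +
            η * T * ((P.alpha / P.Q + 1) / (1 - Real.exp (-1)) + P.d)) ∧
    (∃ C : ℝ, 0 < C ∧
      ∀ {A K Ω : Type*} [Fintype A] [Nonempty A] [Fintype K] [Nonempty K] [MeasurableSpace Ω]
        (μ : MeasureTheory.Measure Ω) [MeasureTheory.IsProbabilityMeasure μ]
        (P : CoopInstance A K) (η : ℝ) (X : ℕ → Ω → RoundOutcome A K) (T : ℕ),
        1 ≤ T → η = √(Real.log (Fintype.card K) / (T * (P.alpha / P.Q + P.d + 1))) →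
        P.IsRun η X μ →
        P.regret X μ T / P.Q ≤
          C * √(Real.log (Fintype.card K) * (P.alpha / P.Q + P.d) * T)) := by
  refine ⟨?_, 8, by norm_num, ?_⟩
  · intro A K Ω _ _ _ _ _ μ _ P η X T hη hX
    exact hX.regret_div_Q_le hη T
  · intro A K Ω _ _ _ _ _ μ _ P η X T hT hη hX
    exact hX.regret_div_Q_le_sqrt hT hη
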